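/- **Setting.** Graphs are finite and undirected (loops are allowed): a graph $\mathcal G$ consists of a finite vertex set $V$ and a symmetric relation $\mathcal E\subseteq V\times V$, and $A_{\mathcal G}\in\{0,1\}^{V\times V}$ is its adjacency matrix. *Colour refinement* (1-WL) gives all vertices the same colour in round $0$; the colour of $x$ in round $k+1$ is the pair of the colour of $x$ in round $k$ and the multiset of the round-$k$ colours of the neighbours of $x$. Two graphs $\mathcal G,\mathcal H$ are *indistinguishable by 1-WL* if, for every $k$, they have the same multiset of round-$k$ colours of their vertices. $\mathrm{ML}(\mathcal L_1)$, with $\mathcal L_1=\{\cdot,{}^{\mathsf T},\mathbf 1,\mathrm{diag}\}$, is the set of expressions built from one square matrix variable $X$ by matrix products of matching formats, transposition, $e\mapsto\mathbf 1(e)$ (the all-ones column vector with as many entries as $e$ has rows), and $e\mapsto\mathrm{diag}(e)$ for column vectors $e$ (including scalars). A *sentence* is an expression whose value is a scalar. The value $e(A)$ of an expression $e$ at a graph is obtained by putting $X=A$, the adjacency matrix of the graph. The full grammar $G_{\mathcal L_1}$ is the context-free grammar with start variable $S$ and rules $$\begin{aligned} S &\to (V_r)(V_c)\mid \mathrm{diag}(S)\mid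 SS, & V_c &\to MV_c\mid {}^{\mathsf T}(V_r)\mid V_cS\mid \mathbf 1,\\ V_r &\to V_rM\mid {}^{\mathsf T}(V_c)\mid SV_r, & M &\to MM\mid {}^{\mathsf T}(M)\mid \mathrm{diag}(V_c)\mid (V_c)(V_r)\mid A . \end{aligned}$$ The reduced grammar $r\text{-}G_{\mathcal L_1}$ is the context-free grammar with the single variable $V_c$ and rules $$V_c\to \mathrm{diag}(V_c)\,V_c\mid A\,V_c\mid \mathbf 1 .$$ Words generated by the full grammar are read as sentences, and words generated by the reduced grammar as column vector expressions, of $\mathrm{ML}(\mathcal L_1)$, with $A$ standing for $X$. **Theorem.** The reduced grammar $r\text{-}G_{\mathcal L_1}$ is as expressive as 1-WL. That is, for all graphs $\mathcal G$ and $\mathcal H$ (possibly of different sizes) the following are equivalent: 1. $\mathcal G$ and $\mathcal H$ are indistinguishable by 1-WL; 2. for every vector $w$ generated by $r\text{-}G_{\mathcal L_1}$, the vectors $w(A_{\mathcal G})$ and $w(A_{\mathcal H})$ have the same multiset of entries; 3. for all vectors $w_1,w_2$ generated by $r\text{-}G_{\mathcal L_1}$, $w_1(A_{\mathcal G})^{\mathsf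 T}w_2(A_{\mathcal G})=w_1(A_{\mathcal H})^{\mathsf T}w_2(A_{\mathcal H})$; 4. $s(A_{\mathcal G})=s(A_{\mathcal H})$ for every sentence $s$ generated by the full grammar $G_{\mathcal L_1}$; 5. $s(A_{\mathcal G})=s(A_{\mathcal H})$ for every sentence $s$ of $\mathrm{ML}(\mathcal L_1)$. Moreover, the same holds on the level of vertices: a vertex $x$ of $\mathcal G$ and a vertex $y$ of $\mathcal H$ have the same colour in every round of colour refinement if and only if $w(A_{\mathcal G})_x=w(A_{\mathcal H})_y$ for every vector $w$ generated by $r\text{-}G_{\mathcal L_1}$. -/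

import Mathlib

universe u v

/-! ### The one-dimensional Weisfeiler-Lehman test

A graph is a set `E ⊆ V × V` of edges on a finite vertex set, i.e. a `Digraph`. The theorem is
about undirected graphs, i.e. symmetric `G.Adj`; loops are allowed. -/

namespace WL

/-- Colours used in round `k` of colour refinement. All vertices start with the same colour, and the
colour in round `k + 1` is the pair of the previous colour and the multiset of the previous colours
of the neighbours. These colours are canonical, so they can be compared across graphs. -/
def Color : ℕ → Type
  | 0 => Unit
  | k + 1 => Color k × Multiset (Color k)

open Classical in
/-- The colour of a vertex after `k` rounds of colour refinement. -/
noncomputable def color {V : Type u} [Fintype V] (G : Digraph V) : (k : ℕ) → V → Color k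
  | 0 => fun _ => ()
  | k + 1 => fun x =>
      (color G k x, (Finset.univ.filter fun y => G.Adj x y).val.map (color G k))

/-- Two graphs are indistinguishable by the `1`-WL test: in every round, every colour occurs equally
often in both graphs. -/
def Indistinguishable {V : Type u} {W : Type v} [Fintype V] [Fintype W]
    (G : Digraph V) (H : Digraph W) : Prop :=
  ∀ k : ℕ, (Finset.univ : Finset V).val.map (color G k) =
    (Finset.univ : Finset W).val.map (color H k)

/-- Two vertices (of the same graph or of different graphs) have the same colour in all rounds of
colour refinement. -/
def SameColor {V : Type u} {W : Type v} [Fintype V] [Fintype W]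
    (G : Digraph V) (H : Digraph W) (x : V) (y : W) : Prop :=
  ∀ k : ℕ, color G k x = color H k y

end WL

/-! ### The fragment of MATLANG with the operations product, transpose, `1` and `diag` -/

namespace ML1

/-- The two possible dimensions of an expression in one square matrix variable of size `n × n`. -/
inductive Dim
  | n
  | one

/-- The index set of a dimension: the vertex set for `n`, a single point for `one`. -/
def Dim.Index (V : Type u) : Dim → Type u
  | .n => V
  | .one => PUnit

instance (V : Type u) [Fintype V] : (d : Dim) → Fintype (d.Index V)
  | .n => inferInstanceAs (Fintype V)
  | .one => inferInstanceAs (Fintype PUnit)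

/-- Expressions of the fragment, in one matrix variable `X` of size `n × n`, together with their
format: `Expr a b` are the expressions whose value is an `a × b` matrix. So `Expr .n .n` are the
square matrices, `Expr .n .one` the column vectors, `Expr .one .n` the row vectors, and
`Expr .one .one` the scalars, i.e. the sentences. -/
inductive Expr : Dim → Dim → Type
  | X : Expr .n .n
  | mul {a b c : Dim} (e : Expr a b) (f : Expr b c) : Expr a c
  | transpose {a b : Dim} (e : Expr a b) : Expr b a
  | ones {a b : Dim} (e : Expr a b) : Expr a .one
  | diag {a : Dim} (e : Expr a .one) : Expr a a

open Classical in
/-- The value of an expression at the matrix `A`. -/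
noncomputable def Expr.eval {V : Type u} [Fintype V] (A : Matrix V V ℝ) :
    {a b : Dim} → Expr a b → Matrix (a.Index V) (b.Index V) ℝ
  | _, _, .X => A
  | _, _, .mul e f => e.eval A * f.eval A
  | _, _, .transpose e => (e.eval A).transpose
  | _, _, .ones _ => Matrix.of fun _ _ => 1
  | _, _, .diag e => Matrix.diagonal fun i => e.eval A i PUnit.unit

open Classical in
/-- The adjacency matrix of a graph. -/
noncomputable def adjMatrix {V : Type u} (G : Digraph V) : Matrix V V ℝ :=
  Matrix.of fun x y => if G.Adj x y then 1 else 0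

/-- The real number `s(A)` for a sentence `s`, where `A` is the adjacency matrix of `G`. -/
noncomputable def Expr.scalar {V : Type u} [Fintype V] (s : Expr .one .one) (G : Digraph V) : ℝ :=
  s.eval (adjMatrix G) PUnit.unit PUnit.unit

/-- The vector `w(A)` for a column vector expression `w`, where `A` is the adjacency matrix
of `G`. -/
noncomputable def Expr.vector {V : Type u} [Fintype V] (w : Expr .n .one) (G : Digraph V) : V → ℝ :=
  fun x => w.eval (adjMatrix G) x PUnit.unit

/-! ### Words and context-free grammars -/

/-- Terminal symbols: the adjacency matrix, the vector `1`, `diag`, the transpose (written in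
front of its argument), and parentheses. -/
inductive Token
  | A
  | one
  | diag
  | transp
  | lpar
  | rpar
  deriving DecidableEq

/-- The written form of a product `e f`, given those of `e` and `f`. The two products of a row
vector and a column vector are written `(e)(f)`, all other ones `e f`. -/
def mulWord : Dim → Dim → Dim → List Token → List Token → List Token
  | .one, .n, .one, e, f => [.lpar] ++ e ++ [.rpar, .lpar] ++ f ++ [.rpar]
  | .n, .one, .n, e, f => [.lpar] ++ e ++ [.rpar, .lpar] ++ f ++ [.rpar]
  | _, _, _, e, f => e ++ f

/-- The written form of an expression. The argument of `1`, which only determines the number of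
rows, is not written. -/
def Expr.word : {a b : Dim} → Expr a b → List Token
  | _, _, .X => [.A]
  | _, _, .mul (a := a) (b := b) (c := c) e f => mulWord a b c e.word f.word
  | _, _, .transpose e => [.transp, .lpar] ++ e.word ++ [.rpar]
  | _, _, .ones _ => [.one]
  | _, _, .diag e => [.diag, .lpar] ++ e.word ++ [.rpar]

/-- Variables of the full grammar: scalars, column vectors, row vectors, square matrices. -/
inductive FullVar
  | S
  | Vc
  | Vr
  | M
  deriving DecidableEq

/-- The only variable of the reduced grammar: column vectors. -/
inductive RedVar
  | Vc
  deriving DecidableEq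

open Symbol in
/-- The rules of the full grammar:

* `S → (Vr)(Vc) | diag(S) | S S`
* `Vc → M Vc | ᵗ(Vr) | Vc S | 1`
* `Vr → Vr M | ᵗ(Vc) | S Vr`
* `M → M M | ᵗ(M) | diag(Vc) | (Vc)(Vr) | A` -/
def fullRules : Finset (ContextFreeRule Token FullVar) :=
  { ⟨.S, [terminal .lpar, nonterminal .Vr, terminal .rpar,
      terminal .lpar, nonterminal .Vc, terminal .rpar]⟩,
    ⟨.S, [terminal .diag, terminal .lpar, nonterminal .S, terminal .rpar]⟩,
    ⟨.S, [nonterminal .S, nonterminal .S]⟩,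
    ⟨.Vc, [nonterminal .M, nonterminal .Vc]⟩,
    ⟨.Vc, [terminal .transp, terminal .lpar, nonterminal .Vr, terminal .rpar]⟩,
    ⟨.Vc, [nonterminal .Vc, nonterminal .S]⟩,
    ⟨.Vc, [terminal .one]⟩,
    ⟨.Vr, [nonterminal .Vr, nonterminal .M]⟩,
    ⟨.Vr, [terminal .transp, terminal .lpar, nonterminal .Vc, terminal .rpar]⟩,
    ⟨.Vr, [nonterminal .S, nonterminal .Vr]⟩,
    ⟨.M, [nonterminal .M, nonterminal .M]⟩,
    ⟨.M, [terminal .transp, terminal .lpar, nonterminal .M, terminal .rpar]⟩,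
    ⟨.M, [terminal .diag, terminal .lpar, nonterminal .Vc, terminal .rpar]⟩,
    ⟨.M, [terminal .lpar, nonterminal .Vc, terminal .rpar,
      terminal .lpar, nonterminal .Vr, terminal .rpar]⟩,
    ⟨.M, [terminal .A]⟩ }

/-- The full grammar; its start variable is `S`. -/
abbrev fullGrammar : ContextFreeGrammar Token where
  NT := FullVar
  initial := .S
  rules := fullRules

open Symbol in
/-- The rules `Vc → diag(Vc) Vc | A Vc | 1` of the reduced grammar. -/
def reducedRules : Finset (ContextFreeRule Token RedVar) :=
  { ⟨.Vc, [terminal .diag, terminal .lpar, nonterminal .Vc, terminal .rpar, nonterminal .Vc]⟩,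
    ⟨.Vc, [terminal .A, nonterminal .Vc]⟩,
    ⟨.Vc, [terminal .one]⟩ }

/-- The reduced grammar; its start variable is `Vc`. -/
abbrev reducedGrammar : ContextFreeGrammar Token where
  NT := RedVar
  initial := .Vc
  rules := reducedRules

/-- The sentences generated by the full grammar: the scalar expressions whose written form is a word
of its language. (Every word of the language is the written form of such an expression.) -/
def fullSentences : Set (Expr .one .one) :=
  {s | s.word ∈ fullGrammar.language}

/-- The column vectors generated by the reduced grammar: the column vector expressions whose written
form is a word of its language. (Every word of the language is the written form of such an
expression, and all expressions with the same written form have the same value.) -/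
def reducedVectors : Set (Expr .n .one) :=
  {w | w.word ∈ reducedGrammar.language}

end ML1

/-! Two inclusions carry the theorem. Soundness: call vectors over the two graphs compatible if
their entries are one common function of the stable colours. Multiplication by the adjacency matrix
preserves compatibility, since equal stable colours force equal multisets of stable colours among
the neighbours; so do `diag` and `1`. Hence reduced vectors depend only on the stable colour
(`preserving_eval_of_notMem`). Transposition adds sums over all vertices, which agree for
indistinguishable graphs, so every sentence agrees (`preserving_eval_and_transpose`).

Completeness: on the disjoint union of the vertex sets, the reduced vectors contain `1` and are
closed under pointwise products, so their span is an algebra, and it is stable under summation over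
neighbours. A subalgebra of functions on a finite set contains the indicators of its inseparability
classes (`Subalgebra.indicator_mem`), so sums of its members count how often each class occurs. By
induction on the round, vertices that reduced vectors do not separate have equal colours
(`color_eq_of_inseparable`); total sums then recover the multisets of colours. -/

namespace ContextFreeGrammar

/-! ### Derivations in context-free grammars -/

variable {T : Type*} {g : ContextFreeGrammar T}

lemma derives_output {r : ContextFreeRule T g.NT} (hr : r ∈ g.rules) :
    g.Derives [.nonterminal r.input] r.output :=
  Produces.single ⟨r, hr, ContextFreeRule.Rewrites.input_output⟩

lemma Derives.append {u u' v v' : List (Symbol T g.NT)} (hu : g.Derives u u')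
    (hv : g.Derives v v') : g.Derives (u ++ v) (u' ++ v') :=
  (hu.append_right v).trans (hv.append_left u')

/-- A property of sentential forms that is inherited by their symbols and satisfied by the right
hand sides of all rules passes to everything derived. -/
lemma Derives.forall_mem {p : Symbol T g.NT → Prop}
    (hp : ∀ r ∈ g.rules, ∀ s ∈ r.output, p s) {u v : List (Symbol T g.NT)}
    (huv : g.Derives u v) (hu : ∀ s ∈ u, p s) : ∀ s ∈ v, p s := by
  induction huv with
  | refl => exact hu
  | tail _ hvw ih =>
    obtain ⟨r, hr, hrw⟩ := hvw
    obtain ⟨a, b, rfl, rfl⟩ := hrw.exists_parts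
    intro s hs
    simp only [List.mem_append] at hs
    rcases hs with (hs | hs) | hs
    · exact ih s (by simp [hs])
    · exact hp r hr s hs
    · exact ih s (by simp [hs])

end ContextFreeGrammar

/-! ### Closure properties of the reduced and the full language -/

namespace ML1

open ContextFreeGrammar Symbol

/-- Sentential forms of the reduced grammar read as sentential forms of the full grammar. -/
def embedSymbol : Symbol Token RedVar → Symbol Token FullVar
  | .terminal t => .terminal t
  | .nonterminal _ => .nonterminal .Vc

/-- The two recursive rules of the reduced grammar are `Vc → M Vc` followed by a rule for `M`. -/
lemma fullGrammar_derives_of_rule {r : ContextFreeRule Token RedVar} (hr : r ∈ reducedRules) :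
    fullGrammar.Derives [nonterminal FullVar.Vc] (r.output.map embedSymbol) := by
  have hMV : fullGrammar.Derives [nonterminal FullVar.Vc]
      [nonterminal FullVar.M, nonterminal FullVar.Vc] :=
    derives_output (g := fullGrammar)
      (r := ⟨.Vc, [nonterminal .M, nonterminal .Vc]⟩) (by simp [fullRules])
  simp only [reducedRules, Finset.mem_insert, Finset.mem_singleton] at hr
  rcases hr with rfl | rfl | rfl
  · exact hMV.trans ((derives_output (g := fullGrammar) (r := ⟨.M, [terminal .diag,
      terminal .lpar, nonterminal .Vc, terminal .rpar]⟩) (by simp [fullRules])).append_right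
        [nonterminal FullVar.Vc])
  · exact hMV.trans ((derives_output (g := fullGrammar) (r := ⟨.M, [terminal .A]⟩)
      (by simp [fullRules])).append_right [nonterminal FullVar.Vc])
  · exact derives_output (g := fullGrammar) (r := ⟨.Vc, [terminal .one]⟩) (by simp [fullRules])

lemma fullGrammar_derives_of_reducedGrammar {u v : List (Symbol Token RedVar)}
    (h : reducedGrammar.Derives u v) :
    fullGrammar.Derives (u.map embedSymbol) (v.map embedSymbol) := by
  induction h with
  | refl => rfl
  | tail _ hvw ih =>
    obtain ⟨r, hr, hrw⟩ := hvw
    obtain ⟨a, b, rfl, rfl⟩ := hrw.exists_parts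
    refine ih.trans ?_
    simp only [List.map_append, List.map_cons, List.map_nil]
    exact ((fullGrammar_derives_of_rule hr).append_left _).append_right _

lemma fullGrammar_derives_word {w : Expr .n .one} (hw : w ∈ reducedVectors) :
    fullGrammar.Derives [nonterminal FullVar.Vc] (w.word.map terminal) := by
  have := fullGrammar_derives_of_reducedGrammar hw
  rw [List.map_map] at this
  exact this

lemma ones_mem_reducedVectors {b : Dim} (e : Expr .n b) : e.ones ∈ reducedVectors :=
  derives_output (g := reducedGrammar) (r := ⟨.Vc, [terminal .one]⟩) (by simp [reducedRules])

lemma X_mul_mem_reducedVectors {w : Expr .n .one} (hw : w ∈ reducedVectors) :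
    Expr.X.mul w ∈ reducedVectors := by
  have h := (derives_output (g := reducedGrammar)
    (r := ⟨.Vc, [terminal .A, nonterminal .Vc]⟩) (by simp [reducedRules])).trans
      (Derives.append_left hw [terminal .A])
  exact h

lemma diag_mul_mem_reducedVectors {w₁ w₂ : Expr .n .one} (h₁ : w₁ ∈ reducedVectors)
    (h₂ : w₂ ∈ reducedVectors) : w₁.diag.mul w₂ ∈ reducedVectors := by
  have h := (derives_output (g := reducedGrammar) (r := ⟨.Vc, [terminal .diag,
    terminal .lpar, nonterminal .Vc, terminal .rpar, nonterminal .Vc]⟩)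
      (by simp [reducedRules])).trans
      ((Derives.append_left h₁ [terminal .diag, terminal .lpar]).append
        (Derives.append_left h₂ [terminal .rpar]))
  change reducedGrammar.Derives _ (((Expr.diag w₁).mul w₂).word.map terminal)
  simpa [Expr.word, mulWord] using h

lemma transpose_mul_mem_fullSentences {w₁ w₂ : Expr .n .one} (h₁ : w₁ ∈ reducedVectors)
    (h₂ : w₂ ∈ reducedVectors) : w₁.transpose.mul w₂ ∈ fullSentences := by
  have hr : fullGrammar.Derives [nonterminal FullVar.Vr] (w₁.transpose.word.map terminal) := by
    have h := (derives_output (g := fullGrammar) (r := ⟨.Vr, [terminal .transp, terminal .lpar,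
      nonterminal .Vc, terminal .rpar]⟩) (by simp [fullRules])).trans
        (((fullGrammar_derives_word h₁).append_left [terminal .transp, terminal .lpar]).append_right
          [terminal .rpar])
    simpa [Expr.word] using h
  have h := (derives_output (g := fullGrammar) (r := ⟨.S, [terminal .lpar, nonterminal .Vr,
    terminal .rpar, terminal .lpar, nonterminal .Vc, terminal .rpar]⟩) (by simp [fullRules])).trans
      ((hr.append_left [terminal .lpar]).append
        (((fullGrammar_derives_word h₂).append_left
          [terminal .rpar, terminal .lpar]).append_right [terminal .rpar]))
  change fullGrammar.Derives _ ((w₁.transpose.mul w₂).word.map terminal)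
  simpa [Expr.word, mulWord] using h

lemma transp_notMem_word {w : Expr .n .one} (hw : w ∈ reducedVectors) :
    Token.transp ∉ w.word := by
  intro hmem
  refine Derives.forall_mem (g := reducedGrammar) (p := (· ≠ terminal Token.transp)) ?_ hw
    (by simp) (terminal Token.transp) (List.mem_map_of_mem hmem) rfl
  simp [reducedRules]

end ML1

/-! ### Stable colours -/

namespace WL

variable {V : Type u} {W : Type v} [Fintype V] [Fintype W] {G : Digraph V} {H : Digraph W}

/-- The sequence of the colours of a vertex in all rounds. -/
noncomputable def stableColor (G : Digraph V) (x : V) : (k : ℕ) → Color k := fun k => color G k x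

lemma sameColor_iff_stableColor_eq {x : V} {y : W} :
    SameColor G H x y ↔ stableColor G x = stableColor H y := funext_iff.symm

end WL

/-- A sequence of refining colourings of a finite type becomes stable. -/
lemma exists_factor_of_refining {Z : Type*} [Finite Z] {C : ℕ → Type*} (c : (k : ℕ) → Z → C k)
    (hc : ∀ k x y, c (k + 1) x = c (k + 1) y → c k x = c k y) :
    ∃ (k : ℕ) (ψ : C k → (j : ℕ) → C j), ∀ z, ψ (c k z) = fun j => c j z := by
  have hmono : ∀ j k, j ≤ k → ∀ x y, c k x = c k y → c j x = c j y := by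
    intro j k hjk x y
    induction hjk with
    | refl => exact id
    | step _ ih => exact fun h => ih (hc _ x y h)
  -- Each pair that is ever separated is separated in some round; as there are finitely many pairs,
  -- one round `k` separates them all.
  have hex : ∀ p : Z × Z, ∃ k, c k p.1 = c k p.2 → ∀ j, c j p.1 = c j p.2 := by
    intro p
    by_cases h : ∀ j, c j p.1 = c j p.2
    · exact ⟨0, fun _ => h⟩
    · push Not at h
      exact h.imp fun k hk h => absurd h hk
  choose K hK using hex
  obtain ⟨k, hk⟩ := (Set.finite_range K).bddAbove
  -- Without points, `ψ` must still be total: it is constant if all `C j` are inhabited, and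
  -- otherwise its domain is chosen empty.
  rcases isEmpty_or_nonempty Z with hZ | ⟨⟨z₀⟩⟩
  · by_cases hC : Nonempty ((j : ℕ) → C j)
    · exact ⟨0, fun _ => hC.some, fun z => hZ.elim z⟩
    · obtain ⟨j, hj⟩ : ∃ j, IsEmpty (C j) := by
        by_contra! h
        exact hC ⟨fun j => (h j).some⟩
      exact ⟨j, fun a => hj.elim a, fun z => hZ.elim z⟩
  · refine ⟨k, fun a => Function.extend (c k) (fun z j => c j z) (fun _ j => c j z₀) a, fun z => ?_⟩
    refine Function.FactorsThrough.extend_apply (fun x y hxy => funext ?_) _ z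
    exact hK (x, y) (hmono _ _ (hk ⟨(x, y), rfl⟩) x y hxy)

namespace WL

variable {V : Type u} {W : Type v} [Fintype V] [Fintype W] {G : Digraph V} {H : Digraph W}

/-- Stabilisation is applied to both graphs jointly, so that a single round and a single `ψ` recover
the stable colours in each. -/
lemma map_stableColor_eq {s : Multiset V} {t : Multiset W}
    (h : ∀ k, s.map (color G k) = t.map (color H k)) :
    s.map (stableColor G) = t.map (stableColor H) := by
  obtain ⟨k, ψ, hψ⟩ := exists_factor_of_refining
    (fun k => Sum.elim (color G k) (color H k)) (by
      rintro k (x | x) (y | y) hxy <;> exact congrArg Prod.fst hxy)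
  have hG : stableColor G = ψ ∘ color G k := funext fun x => (hψ (.inl x)).symm
  have hH : stableColor H = ψ ∘ color H k := funext fun x => (hψ (.inr x)).symm
  rw [hG, hH, ← Multiset.map_map, ← Multiset.map_map, h]

/-- The multiset of the neighbours of a vertex. -/
noncomputable def neighbors (G : Digraph V) (x : V) : Multiset V :=
  open Classical in (Finset.univ.filter fun y => G.Adj x y).val

lemma map_neighbors_stableColor_eq {x : V} {y : W} (h : stableColor G x = stableColor H y) :
    (neighbors G x).map (stableColor G) = (neighbors H y).map (stableColor H) :=
  map_stableColor_eq fun k => congrArg Prod.snd (congrFun h (k + 1))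

end WL

/-! ### Soundness: expressions respect stable colours -/

namespace ML1

open WL Matrix

lemma adjMatrix_mulVec {V : Type u} [Fintype V] (G : Digraph V) (f : V → ℝ) (x : V) :
    (adjMatrix G *ᵥ f) x = ((neighbors G x).map f).sum := by
  classical
  simp only [adjMatrix, mulVec, dotProduct, of_apply, ite_mul, one_mul, zero_mul]
  rw [← Finset.sum_filter, neighbors, Finset.sum]

variable {V : Type u} {W : Type v} [Fintype V] [Fintype W] {G : Digraph V} {H : Digraph W}

/-- Vectors over two graphs are compatible if their entries are the same function of the stable
colours; for the dimension `one`, if they are equal. -/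
def Compatible (G : Digraph V) (H : Digraph W) :
    (d : Dim) → (d.Index V → ℝ) → (d.Index W → ℝ) → Prop
  | .n, f, g => ∃ φ : ((k : ℕ) → Color k) → ℝ, f = φ ∘ stableColor G ∧ g = φ ∘ stableColor H
  | .one, f, g => f PUnit.unit = g PUnit.unit

lemma compatible_const (r : ℝ) : ∀ d, Compatible G H d (fun _ => r) fun _ => r
  | .n => ⟨fun _ => r, rfl, rfl⟩
  | .one => rfl

lemma Compatible.mul : ∀ {d : Dim} {f f' : d.Index V → ℝ} {g g' : d.Index W → ℝ},
    Compatible G H d f g → Compatible G H d f' g' → Compatible G H d (f * f') (g * g')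
  | .n, _, _, _, _, ⟨φ, hf, hg⟩, ⟨φ', hf', hg'⟩ =>
    ⟨φ * φ', by rw [hf, hf']; rfl, by rw [hg, hg']; rfl⟩
  | .one, _, _, _, _, h, h' => congrArg₂ (· * ·) h h'

lemma Compatible.adjMatrix_mulVec {f : V → ℝ} {g : W → ℝ} (h : Compatible G H .n f g) :
    Compatible G H .n (adjMatrix G *ᵥ f) (adjMatrix H *ᵥ g) := by
  obtain ⟨φ, rfl, rfl⟩ := h
  have key : ∀ z z' : V ⊕ W, Sum.elim (stableColor G) (stableColor H) z =
      Sum.elim (stableColor G) (stableColor H) z' →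
      Sum.elim (adjMatrix G *ᵥ (φ ∘ stableColor G)) (adjMatrix H *ᵥ (φ ∘ stableColor H)) z =
      Sum.elim (adjMatrix G *ᵥ (φ ∘ stableColor G)) (adjMatrix H *ᵥ (φ ∘ stableColor H)) z' := by
    rintro (x | x) (y | y) h <;>
    · simp only [Sum.elim_inl, Sum.elim_inr] at h
      simp only [Sum.elim_inl, Sum.elim_inr, ML1.adjMatrix_mulVec, ← Multiset.map_map,
        map_neighbors_stableColor_eq h]
  -- By `key` the products factor through the stable colours; the value `0` at colours that do not
  -- occur is arbitrary.
  refine ⟨Function.extend (Sum.elim (stableColor G) (stableColor H)) (Sum.elim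
    (adjMatrix G *ᵥ (φ ∘ stableColor G)) (adjMatrix H *ᵥ (φ ∘ stableColor H))) 0, ?_, ?_⟩
  · exact funext fun x => (Function.FactorsThrough.extend_apply (fun z z' => key z z') 0
      (Sum.inl x)).symm
  · exact funext fun x => (Function.FactorsThrough.extend_apply (fun z z' => key z z') 0
      (Sum.inr x)).symm

lemma sum_index_one (f : Dim.one.Index V → ℝ) : ∑ i, f i = f PUnit.unit :=
  Fintype.sum_unique (ι := PUnit) f

lemma Compatible.sum_eq (hGH : Indistinguishable G H) :
    ∀ {d : Dim} {f : d.Index V → ℝ} {g : d.Index W → ℝ}, Compatible G H d f g →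
      ∑ i, f i = ∑ i, g i
  | .n, _, _, ⟨φ, hf, hg⟩ => by
    rw [hf, hg]
    have h := congrArg (fun s => (s.map φ).sum) (map_stableColor_eq hGH)
    simp only [Multiset.map_map] at h
    exact h
  | .one, f, g, h => by
    rwa [sum_index_one, sum_index_one]

/-- Matrices over two graphs whose products with compatible vectors are compatible. -/
def Preserving (G : Digraph V) (H : Digraph W) {a b : Dim}
    (M : Matrix (a.Index V) (b.Index V) ℝ) (N : Matrix (a.Index W) (b.Index W) ℝ) : Prop :=
  ∀ f g, Compatible G H b f g → Compatible G H a (M *ᵥ f) (N *ᵥ g)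

lemma Preserving.mul {a b c : Dim} {M : Matrix (a.Index V) (b.Index V) ℝ}
    {N : Matrix (a.Index W) (b.Index W) ℝ} {M' : Matrix (b.Index V) (c.Index V) ℝ}
    {N' : Matrix (b.Index W) (c.Index W) ℝ} (h : Preserving G H M N) (h' : Preserving G H M' N') :
    Preserving G H (M * M') (N * N') := by
  intro f g hfg
  rw [← mulVec_mulVec, ← mulVec_mulVec]
  exact h _ _ (h' _ _ hfg)

lemma mulVec_const_one {m : Type*} (M : Matrix m PUnit ℝ) :
    (M *ᵥ fun _ => 1) = fun i => M i PUnit.unit := by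
  ext i
  simp [mulVec, dotProduct]

/-- Apply the matrices to the scalar `1`. This turns preservation into a statement about values; for
sentences it is equality. -/
lemma Preserving.compatible_col {a : Dim} {M : Matrix (a.Index V) (Dim.one.Index V) ℝ}
    {N : Matrix (a.Index W) (Dim.one.Index W) ℝ} (h : Preserving G H M N) :
    Compatible G H a (fun i => M i PUnit.unit) fun i => N i PUnit.unit := by
  have := h _ _ (compatible_const 1 .one)
  rwa [show (M *ᵥ fun _ => 1) = _ from mulVec_const_one M,
    show (N *ᵥ fun _ => 1) = _ from mulVec_const_one N] at this

lemma Preserving.eval_diag {a : Dim} {e : Expr a .one}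
    (h : Preserving G H (e.eval (adjMatrix G)) (e.eval (adjMatrix H))) :
    Preserving G H (e.diag.eval (adjMatrix G)) (e.diag.eval (adjMatrix H)) := by
  classical
  intro f g hfg
  convert h.compatible_col.mul hfg using 1 <;>
  · ext i
    simp only [Expr.eval, Pi.mul_apply]
    convert mulVec_diagonal _ _ _

lemma preserving_eval_ones {a b : Dim} (e : Expr a b) :
    Preserving G H (e.ones.eval (adjMatrix G)) (e.ones.eval (adjMatrix H)) := by
  intro f g hfg
  have keyG : (e.ones.eval (adjMatrix G) *ᵥ f) = fun _ => f PUnit.unit :=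
    funext fun i => (Finset.sum_congr rfl fun j _ => one_mul (f j)).trans (sum_index_one f)
  have keyH : (e.ones.eval (adjMatrix H) *ᵥ g) = fun _ => g PUnit.unit :=
    funext fun i => (Finset.sum_congr rfl fun j _ => one_mul (g j)).trans (sum_index_one g)
  rw [keyG, keyH, show f PUnit.unit = g PUnit.unit from hfg]
  exact compatible_const _ a

/-- The induction runs over expressions, not derivations, because a word forgets bracketing and the
arguments of `1`. Without transposition nothing is summed over all vertices, so indistinguishability
is not needed and the result applies to single vertices. -/
lemma preserving_eval_of_notMem {a b : Dim} (e : Expr a b) (he : Token.transp ∉ e.word) :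
    Preserving G H (e.eval (adjMatrix G)) (e.eval (adjMatrix H)) := by
  induction e with
  | X => exact fun _ _ h => h.adjMatrix_mulVec
  | @mul a b c e f ihe ihf =>
    have h : Token.transp ∉ e.word ∧ Token.transp ∉ f.word := by
      cases a <;> cases b <;> cases c <;> simpa [Expr.word, mulWord] using he
    exact (ihe h.1).mul (ihf h.2)
  | transpose e => simp [Expr.word] at he
  | ones e => exact preserving_eval_ones e
  | diag e ih => exact (ih (by simpa [Expr.word] using he)).eval_diag

lemma adjMatrix_transpose {V : Type u} {G : Digraph V} (hG : ∀ x y, G.Adj x y → G.Adj y x) :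
    (adjMatrix G)ᵀ = adjMatrix G := by
  ext x y
  simp only [adjMatrix, transpose_apply, of_apply]
  congr 1
  exact propext ⟨hG y x, hG x y⟩

lemma Compatible.adjMatrix_transpose_mulVec (hG : ∀ x y, G.Adj x y → G.Adj y x)
    (hH : ∀ x y, H.Adj x y → H.Adj y x) {f : V → ℝ} {g : W → ℝ} (h : Compatible G H .n f g) :
    Compatible G H .n ((adjMatrix G)ᵀ *ᵥ f) ((adjMatrix H)ᵀ *ᵥ g) := by
  obtain ⟨φ, hf, hg⟩ := h.adjMatrix_mulVec
  exact ⟨φ, (congrArg (· *ᵥ f) (adjMatrix_transpose hG)).trans hf,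
    (congrArg (· *ᵥ g) (adjMatrix_transpose hH)).trans hg⟩

/-- Both halves are proved together because transposition swaps them and reverses products. -/
lemma preserving_eval_and_transpose (hG : ∀ x y, G.Adj x y → G.Adj y x)
    (hH : ∀ x y, H.Adj x y → H.Adj y x) (hGH : Indistinguishable G H) {a b : Dim}
    (e : Expr a b) :
    Preserving G H (e.eval (adjMatrix G)) (e.eval (adjMatrix H)) ∧
      Preserving G H (e.eval (adjMatrix G))ᵀ (e.eval (adjMatrix H))ᵀ := by
  induction e with
  | X =>
    refine ⟨fun _ _ h => h.adjMatrix_mulVec, fun _ _ h => ?_⟩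
    exact h.adjMatrix_transpose_mulVec hG hH
  | mul e f ihe ihf =>
    refine ⟨ihe.1.mul ihf.1, ?_⟩
    simp only [Expr.eval, transpose_mul]
    exact ihf.2.mul ihe.2
  | transpose e ih => exact ⟨ih.2, ih.1⟩
  | ones e =>
    refine ⟨preserving_eval_ones e, fun f g hfg => ?_⟩
    -- The transposed all-ones vector sums the entries; this is where indistinguishability enters.
    change ∑ i, (1 : ℝ) * f i = ∑ i, (1 : ℝ) * g i
    simpa using hfg.sum_eq hGH
  | diag e ih =>
    refine ⟨ih.1.eval_diag, ?_⟩
    have h := ih.1.eval_diag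
    classical
    simp only [Expr.eval] at h ⊢
    rwa [diagonal_transpose, diagonal_transpose]

lemma exists_vector_eq_comp_stableColor {w : Expr .n .one} (hw : w ∈ reducedVectors) :
    ∃ φ : ((k : ℕ) → Color k) → ℝ,
      w.vector G = φ ∘ stableColor G ∧ w.vector H = φ ∘ stableColor H :=
  (preserving_eval_of_notMem w (transp_notMem_word hw)).compatible_col

lemma scalar_eq_of_indistinguishable (hG : ∀ x y, G.Adj x y → G.Adj y x)
    (hH : ∀ x y, H.Adj x y → H.Adj y x) (hGH : Indistinguishable G H) (s : Expr .one .one) :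
    s.scalar G = s.scalar H :=
  (preserving_eval_and_transpose hG hH hGH s).1.compatible_col

lemma map_vector_eq_of_indistinguishable (hGH : Indistinguishable G H) {w : Expr .n .one}
    (hw : w ∈ reducedVectors) :
    (Finset.univ : Finset V).val.map (w.vector G) =
      (Finset.univ : Finset W).val.map (w.vector H) := by
  obtain ⟨φ, h₁, h₂⟩ := exists_vector_eq_comp_stableColor (G := G) (H := H) hw
  rw [h₁, h₂]
  have := congrArg (Multiset.map φ) (map_stableColor_eq hGH)
  rwa [Multiset.map_map, Multiset.map_map] at this

lemma vector_eq_of_sameColor {x : V} {y : W} (hxy : SameColor G H x y) {w : Expr .n .one}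
    (hw : w ∈ reducedVectors) : w.vector G x = w.vector H y := by
  obtain ⟨φ, h₁, h₂⟩ := exists_vector_eq_comp_stableColor (G := G) (H := H) hw
  rw [h₁, h₂, Function.comp, Function.comp, sameColor_iff_stableColor_eq.1 hxy]

end ML1

/-! ### Subalgebras of functions on a finite set -/

section Separation

variable {Z : Type*} [Finite Z] (S : Subalgebra ℝ (Z → ℝ))

/-- The points of `Z` that a subalgebra of functions does not separate. -/
def Subalgebra.inseparable : Setoid Z where
  r x y := ∀ f ∈ S, f x = f y
  iseqv := ⟨fun _ _ _ => rfl, fun h f hf => (h f hf).symm,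
    fun h h' f hf => (h f hf).trans (h' f hf)⟩

/-- A subalgebra of functions on a finite set contains the indicators of its inseparability
classes. -/
lemma Subalgebra.indicator_mem (x : Z) :
    Set.indicator {z | S.inseparable x z} (1 : Z → ℝ) ∈ S := by
  classical
  cases nonempty_fintype Z
  -- Interpolation point by point: the product of these functions is `1` on the class of `x`, where
  -- members of `S` are constant, and `0` elsewhere.
  have h : ∀ z, ∃ f ∈ S, f x = 1 ∧ (¬ S.inseparable x z → f z = 0) := by
    intro z
    by_cases hz : S.inseparable x z
    · exact ⟨1, S.one_mem, rfl, fun h => absurd hz h⟩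
    · obtain ⟨f, hf, hne⟩ : ∃ f ∈ S, f x ≠ f z := by
        by_contra! h
        exact hz h
      refine ⟨(f x - f z)⁻¹ • (f - algebraMap ℝ _ (f z)),
        S.smul_mem (S.sub_mem hf (S.algebraMap_mem _)) _, ?_, fun _ => ?_⟩
      · simp [inv_mul_cancel₀ (sub_ne_zero.2 hne)]
      · simp
  choose f hf hfx hfz using h
  have hprod : ∏ z, f z ∈ S := S.prod_mem fun z _ => hf z
  convert hprod using 1
  ext y
  rw [Finset.prod_apply]
  by_cases hy : S.inseparable x y
  · rw [Set.indicator_of_mem hy]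
    exact (Finset.prod_eq_one fun z _ => (hy _ (hf z)).symm.trans (hfx z)).symm
  · rw [Set.indicator_of_notMem hy]
    exact (Finset.prod_eq_zero (f := fun z => f z y) (Finset.mem_univ y) (hfz y hy)).symm

/-- If all functions of a subalgebra have the same sum over two multisets, then these multisets have
the same image under every map that is constant on the inseparability classes. -/
lemma Subalgebra.map_eq_map_of_sum_eq {s t : Multiset Z}
    (hst : ∀ f ∈ S, (s.map f).sum = (t.map f).sum) {α : Type*} (c : Z → α)
    (hc : ∀ x y, S.inseparable x y → c x = c y) : s.map c = t.map c := by
  classical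
  -- Summing the indicator of a class over a multiset counts the members of that class.
  have hcount : ∀ (x : Z) (m : Multiset Z),
      (m.map (Set.indicator {z | S.inseparable x z} (1 : Z → ℝ))).sum =
        ((m.map (Quotient.mk S.inseparable)).count ⟦x⟧ : ℝ) := by
    intro x m
    induction m using Multiset.induction_on with
    | empty => simp
    | cons a m ih =>
      rw [Multiset.map_cons, Multiset.sum_cons, ih, Multiset.map_cons, Multiset.count_cons]
      by_cases h : S.inseparable x a
      · rw [Set.indicator_of_mem h, if_pos (Quotient.sound h)]
        simp [add_comm]
      · rw [Set.indicator_of_notMem h, if_neg (fun h' => h (Quotient.exact h'))]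
        simp
  have hmk : s.map (Quotient.mk S.inseparable) = t.map (Quotient.mk S.inseparable) := by
    ext q
    induction q using Quotient.inductionOn with
    | h x =>
      have h := hst _ (S.indicator_mem x)
      rw [hcount, hcount] at h
      exact_mod_cast h
  have h := congrArg (Multiset.map (Quotient.lift c hc)) hmk
  rwa [Multiset.map_map, Multiset.map_map] at h

end Separation

/-! ### Completeness: reduced vectors determine the colours -/

namespace ML1

open WL Matrix

variable {V : Type u} {W : Type v} [Fintype V] [Fintype W] (G : Digraph V) (H : Digraph W)

/-- The values of a column vector at two graphs, as one function. -/
noncomputable def pairVector (w : Expr .n .one) : V ⊕ W → ℝ := Sum.elim (w.vector G) (w.vector H)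

lemma vector_ones {b : Dim} (e : Expr .n b) : e.ones.vector G = 1 := rfl

lemma vector_diag_mul (w₁ w₂ : Expr .n .one) :
    (w₁.diag.mul w₂).vector G = w₁.vector G * w₂.vector G := by
  classical
  ext x
  exact diagonal_mul (n := PUnit) (fun i => w₁.eval (adjMatrix G) i PUnit.unit)
    (w₂.eval (adjMatrix G)) x PUnit.unit

lemma vector_X_mul (w : Expr .n .one) :
    (Expr.X.mul w).vector G = adjMatrix G *ᵥ w.vector G := rfl

/-- The functions given by the vectors of the reduced grammar on the vertices of two graphs. -/
def reducedSubmonoid : Submonoid (V ⊕ W → ℝ) where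
  carrier := pairVector G H '' reducedVectors
  one_mem' := ⟨Expr.X.ones, ones_mem_reducedVectors _, by
    rw [pairVector, vector_ones, vector_ones]; exact Sum.elim_one_one⟩
  mul_mem' := by
    rintro _ _ ⟨w₁, h₁, rfl⟩ ⟨w₂, h₂, rfl⟩
    refine ⟨_, diag_mul_mem_reducedVectors h₁ h₂, ?_⟩
    rw [pairVector, vector_diag_mul, vector_diag_mul, Sum.elim_mul_mul]
    rfl

/-- The subalgebra generated by the vectors of the reduced grammar. -/
noncomputable def reducedSubalgebra : Subalgebra ℝ (V ⊕ W → ℝ) :=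
  Algebra.adjoin ℝ (reducedSubmonoid G H)

/-- Closure under products makes the linear span already an algebra, so linear identities need
checking only on reduced vectors. -/
lemma toSubmodule_reducedSubalgebra :
    Subalgebra.toSubmodule (reducedSubalgebra G H) =
      Submodule.span ℝ (pairVector G H '' reducedVectors) := by
  rw [reducedSubalgebra, Algebra.adjoin_eq_span, Submonoid.closure_eq]
  rfl

lemma pairVector_mem {w : Expr .n .one} (hw : w ∈ reducedVectors) :
    pairVector G H w ∈ reducedSubalgebra G H :=
  Algebra.subset_adjoin ⟨w, hw, rfl⟩

/-- The multiset of the neighbours of a vertex of one of two graphs. -/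
noncomputable def pairNeighbors : V ⊕ W → Multiset (V ⊕ W) :=
  Sum.elim (fun x => (neighbors G x).map Sum.inl) fun y => (neighbors H y).map Sum.inr

/-- Two linear maps which agree on the reduced vectors agree on the subalgebra. -/
lemma linearMap_eq_of_mem {E : Type*} [AddCommGroup E] [Module ℝ E]
    {L L' : (V ⊕ W → ℝ) →ₗ[ℝ] E}
    (h : ∀ w ∈ reducedVectors, L (pairVector G H w) = L' (pairVector G H w)) {f : V ⊕ W → ℝ}
    (hf : f ∈ reducedSubalgebra G H) : L f = L' f := by
  rw [← Subalgebra.mem_toSubmodule, toSubmodule_reducedSubalgebra] at hf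
  exact LinearMap.eqOn_span (by rintro _ ⟨w, hw, rfl⟩; exact h w hw) hf

/-- Summation over the neighbours. -/
noncomputable def neighborSum : (V ⊕ W → ℝ) →ₗ[ℝ] (V ⊕ W → ℝ) where
  toFun f z := ((pairNeighbors G H z).map f).sum
  map_add' f g := by ext z; simp
  map_smul' r f := by ext z; simp [Multiset.sum_map_mul_left]

lemma neighborSum_pairVector (w : Expr .n .one) :
    neighborSum G H (pairVector G H w) = pairVector G H (Expr.X.mul w) := by
  ext (x | x) <;>
  simp [neighborSum, pairNeighbors, pairVector, vector_X_mul, adjMatrix_mulVec, Multiset.map_map]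

lemma neighborSum_mem {f : V ⊕ W → ℝ} (hf : f ∈ reducedSubalgebra G H) :
    neighborSum G H f ∈ reducedSubalgebra G H := by
  rw [← Subalgebra.mem_toSubmodule] at hf ⊢
  revert f
  change Subalgebra.toSubmodule (reducedSubalgebra G H) ≤
    (Subalgebra.toSubmodule (reducedSubalgebra G H)).comap (neighborSum G H)
  conv_lhs => rw [toSubmodule_reducedSubalgebra]
  rw [Submodule.span_le]
  rintro _ ⟨w, hw, rfl⟩
  change neighborSum G H _ ∈ reducedSubalgebra G H
  rw [neighborSum_pairVector]
  exact pairVector_mem G H (X_mul_mem_reducedVectors hw)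

/-- Neighbour sums of members stay in the subalgebra, so at inseparable vertices all members have
equal sums over the neighbours. The neighbours' classes then agree as multisets, and so do their
colours by induction. -/
lemma color_eq_of_inseparable (k : ℕ) :
    ∀ z z', (reducedSubalgebra G H).inseparable z z' →
      Sum.elim (color G k) (color H k) z = Sum.elim (color G k) (color H k) z' := by
  induction k with
  | zero => exact fun _ _ _ => rfl
  | succ k ih =>
    have hcolor : ∀ z, Sum.elim (color G (k + 1)) (color H (k + 1)) z =
        (Sum.elim (color G k) (color H k) z,
          (pairNeighbors G H z).map (Sum.elim (color G k) (color H k))) := by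
      rintro (x | x) <;>
      simp only [Sum.elim_inl, Sum.elim_inr, pairNeighbors, Multiset.map_map, color] <;> rfl
    intro z z' hz
    rw [hcolor, hcolor]
    refine Prod.ext (ih z z' hz) ?_
    exact (reducedSubalgebra G H).map_eq_map_of_sum_eq
      (fun f hf => hz _ (neighborSum_mem G H hf)) _ ih

variable {G H}

lemma sameColor_of_forall_vector_eq {x : V} {y : W}
    (h : ∀ w ∈ reducedVectors, w.vector G x = w.vector H y) : SameColor G H x y := fun k =>
  color_eq_of_inseparable G H k (.inl x) (.inr y) fun _ hf =>
    linearMap_eq_of_mem G H (L := LinearMap.proj (Sum.inl x)) (L' := LinearMap.proj (Sum.inr y))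
      h hf

lemma indistinguishable_of_dotProduct_eq
    (h : ∀ w₁ ∈ reducedVectors, ∀ w₂ ∈ reducedVectors,
      w₁.vector G ⬝ᵥ w₂.vector G = w₁.vector H ⬝ᵥ w₂.vector H) : Indistinguishable G H := by
  intro k
  have hsum : ∀ f ∈ reducedSubalgebra G H, ((Finset.univ.val.map Sum.inl).map f).sum =
      ((Finset.univ.val.map Sum.inr).map f).sum := by
    intro f hf
    rw [Multiset.map_map, Multiset.map_map]
    have := linearMap_eq_of_mem G H
      (L := ∑ x : V, LinearMap.proj (R := ℝ) (φ := fun _ => ℝ) (Sum.inl x))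
      (L' := ∑ y : W, LinearMap.proj (R := ℝ) (φ := fun _ => ℝ) (Sum.inr y)) (fun w hw => by
        -- Pairing with the vector `1` gives the sum of the entries of `w`.
        have h1 := h _ (ones_mem_reducedVectors Expr.X) w hw
        rw [vector_ones, vector_ones, one_dotProduct, one_dotProduct] at h1
        simpa [pairVector] using h1) hf
    simpa using this
  have := (reducedSubalgebra G H).map_eq_map_of_sum_eq hsum _ (color_eq_of_inseparable G H k)
  rwa [Multiset.map_map, Multiset.map_map] at this

lemma dotProduct_vector_eq_sum (w₁ w₂ : Expr .n .one) :
    w₁.vector G ⬝ᵥ w₂.vector G =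
      ((Finset.univ : Finset V).val.map ((w₁.diag.mul w₂).vector G)).sum := by
  rw [vector_diag_mul]
  rfl

lemma scalar_transpose_mul (w₁ w₂ : Expr .n .one) :
    (w₁.transpose.mul w₂).scalar G = w₁.vector G ⬝ᵥ w₂.vector G := rfl

end ML1

theorem theorem2p1 {V : Type u} {W : Type v} [Fintype V] [Fintype W]
    (G : Digraph V) (H : Digraph W)
    (hG : ∀ x y, G.Adj x y → G.Adj y x) (hH : ∀ x y, H.Adj x y → H.Adj y x) :
    List.TFAE
      [ -- `G` and `H` are indistinguishable by `1`-WL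
        WL.Indistinguishable G H,
        -- every vector of the reduced grammar has the same entries, up to their order, on both
        ∀ w ∈ ML1.reducedVectors,
          (Finset.univ : Finset V).val.map (w.vector G) =
            (Finset.univ : Finset W).val.map (w.vector H),
        -- the scalar products of vectors of the reduced grammar have the same values on both
        ∀ w₁ ∈ ML1.reducedVectors, ∀ w₂ ∈ ML1.reducedVectors,
          w₁.vector G ⬝ᵥ w₂.vector G = w₁.vector H ⬝ᵥ w₂.vector H,
        -- the sentences of the full grammar have the same values on both
        ∀ s ∈ ML1.fullSentences, s.scalar G = s.scalar H,
        -- all sentences of the fragment have the same values on both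
        ∀ s : ML1.Expr .one .one, s.scalar G = s.scalar H ] ∧
    -- two vertices get the same colour iff they get the same entry in every vector of the
    -- reduced grammar
    ∀ (x : V) (y : W),
      WL.SameColor G H x y ↔ ∀ w ∈ ML1.reducedVectors, w.vector G x = w.vector H y := by
  refine ⟨?_, fun x y => ⟨fun h w hw => ML1.vector_eq_of_sameColor h hw,
    ML1.sameColor_of_forall_vector_eq⟩⟩
  tfae_have 1 → 5 := ML1.scalar_eq_of_indistinguishable hG hH
  tfae_have 5 → 4 := fun h s _ => h s
  tfae_have 4 → 3 := fun h w₁ h₁ w₂ h₂ => by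
    rw [← ML1.scalar_transpose_mul, ← ML1.scalar_transpose_mul]
    exact h _ (ML1.transpose_mul_mem_fullSentences h₁ h₂)
  tfae_have 3 → 1 := ML1.indistinguishable_of_dotProduct_eq
  tfae_have 1 → 2 := fun h _ hw => ML1.map_vector_eq_of_indistinguishable h hw
  -- A scalar product is the sum of the entries of `diag(w₁) w₂`, which is again a reduced vector.
  tfae_have 2 → 3 := fun h w₁ h₁ w₂ h₂ => by
    rw [ML1.dotProduct_vector_eq_sum, ML1.dotProduct_vector_eq_sum,
      h _ (ML1.diag_mul_mem_reducedVectors h₁ h₂)]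
  tfae_finish
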